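/- Let $X$ and $V$ be Banach spaces over the same field ($\mathbb{R}$ or $\mathbb{C}$) such that $V$ embeds continuously into $X$ (so $V$ is regarded as a subspace of $X$ via an injective bounded linear map). Let $(T(t))_{t\ge 0}$ be a $C_0$-semigroup on $X$ with generator $A$, and suppose that there exist $C\ge 1$ and $\alpha>0$ such that \[ T(t)X\subseteq V \quad\text{and}\quad \|T(t)\|_{X\to V}\le C t^{-\alpha}\qquad\text{for all } t\in(0,1], \] i.e. $(T(t))_{t\ge 0}$ is ultracontractive with respect to $V$, and moreover $\|T(t)\|_{V\to V}\le C$ for all $t\in(0,1]$. Let $B:X\to X$ be a bounded linear operator with $BV\subseteq V$. Then $A+B$, with domain $\operatorname{dom}(A+B)=\operatorname{dom}(A)$, generates a $C_0$-semigroup $(S(t))_{t\ge 0}$ on $X$, and this semigroup is also ultracontractive with respect to $V$, with the same exponent: there exists $\widetilde C\ge 1$ such that \[ S(t)X\subseteq V \quad\text{and}\quad \|S(t)\|_{X\to V}\le \widetilde C t^{-\alpha}\qquad\text{for all } t\in(0,1]. \] -/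

import Mathlib

open Filter Topology
open scoped NNReal

/-- A `C₀`-semigroup of bounded linear operators on a normed space `X`. -/
structure C0Semigroup (𝕜 X : Type*) [RCLike 𝕜] [NormedAddCommGroup X] [NormedSpace 𝕜 X] where
  /-- The operator `T(t)`, `t ≥ 0`. -/
  op : ℝ≥0 → X →L[𝕜] X
  op_zero : op 0 = ContinuousLinearMap.id 𝕜 X
  op_add : ∀ s t : ℝ≥0, op (s + t) = (op s).comp (op t)
  continuous_orbit : ∀ x : X, Continuous fun t : ℝ≥0 => op t x

namespace C0Semigroup

variable {𝕜 X : Type*} [RCLike 𝕜] [NormedAddCommGroup X] [NormedSpace 𝕜 X]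

/-- `y = lim_{h ↓ 0} (T(h) x - x) / h`. -/
def HasGeneratorAt (T : C0Semigroup 𝕜 X) (x y : X) : Prop :=
  Tendsto (fun h : ℝ≥0 => (((h : ℝ) : 𝕜))⁻¹ • (T.op h x - x)) (𝓝[>] 0) (𝓝 y)

theorem HasGeneratorAt.unique {T : C0Semigroup 𝕜 X} {x y z : X}
    (hy : T.HasGeneratorAt x y) (hz : T.HasGeneratorAt x z) : y = z :=
  tendsto_nhds_unique hy hz

theorem HasGeneratorAt.zero (T : C0Semigroup 𝕜 X) : T.HasGeneratorAt 0 0 := by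
  simp [HasGeneratorAt]

theorem HasGeneratorAt.add {T : C0Semigroup 𝕜 X} {x x' y y' : X}
    (h : T.HasGeneratorAt x y) (h' : T.HasGeneratorAt x' y') :
    T.HasGeneratorAt (x + x') (y + y') := by
  refine (Tendsto.add h h').congr fun t => ?_
  rw [← smul_add, map_add]
  congr 1
  abel

theorem HasGeneratorAt.smul {T : C0Semigroup 𝕜 X} {x y : X} (c : 𝕜)
    (h : T.HasGeneratorAt x y) : T.HasGeneratorAt (c • x) (c • y) := by
  refine (Tendsto.const_smul h c).congr fun t => ?_
  rw [smul_comm, smul_sub, map_smul]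

/-- The generator of a `C₀`-semigroup: the operator `A x = lim_{h ↓ 0} (T(h) x - x) / h`, whose
domain is the set of all `x` for which the limit exists in `X`. -/
noncomputable def generator (T : C0Semigroup 𝕜 X) : X →ₗ.[𝕜] X where
  domain :=
    { carrier := {x | ∃ y, T.HasGeneratorAt x y}
      add_mem' := fun ⟨_, h⟩ ⟨_, h'⟩ => ⟨_, h.add h'⟩
      zero_mem' := ⟨0, HasGeneratorAt.zero T⟩
      smul_mem' := fun c _ ⟨_, h⟩ => ⟨_, h.smul c⟩ }
  toFun :=
    { toFun := fun x => Classical.choose x.2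
      map_add' := fun x y => (Classical.choose_spec (x + y).2).unique
        ((Classical.choose_spec x.2).add (Classical.choose_spec y.2))
      map_smul' := fun c x => (Classical.choose_spec (c • x).2).unique
        ((Classical.choose_spec x.2).smul c) }

theorem hasGeneratorAt_generator (T : C0Semigroup 𝕜 X) (x : T.generator.domain) :
    T.HasGeneratorAt x (T.generator x) :=
  Classical.choose_spec x.2

end C0Semigroup

section Embedding

variable {𝕜 E V X : Type*} [RCLike 𝕜] [NormedAddCommGroup E] [NormedSpace 𝕜 E]
  [NormedAddCommGroup V] [NormedSpace 𝕜 V] [NormedAddCommGroup X] [NormedSpace 𝕜 X]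

/-- For a space `V` regarded as a subspace of `X` through the injective map `ι`, the operator
`Q : E → X` maps into `V` and its operator norm satisfies `‖Q‖_{E → V} ≤ K`. -/
def NormIntoLE (ι : V →L[𝕜] X) (Q : E →L[𝕜] X) (K : ℝ) : Prop :=
  Set.range Q ⊆ Set.range ι ∧ ∀ (e : E) (v : V), ι v = Q e → ‖v‖ ≤ K * ‖e‖

/-- `T(t) X ⊆ V` and `‖T(t)‖_{X → V} ≤ C t^{-α}` for all `t ∈ (0, 1]`. -/
def C0Semigroup.UltracontractiveWith (T : C0Semigroup 𝕜 X) (ι : V →L[𝕜] X) (C α : ℝ) : Prop :=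
  ∀ t : ℝ≥0, 0 < t → t ≤ 1 → NormIntoLE ι (T.op t) (C * (t : ℝ) ^ (-α))

/-- `T(t) V ⊆ V` and `‖T(t)‖_{V → V} ≤ C` for all `t ∈ (0, 1]`. -/
def C0Semigroup.BoundedOnWith (T : C0Semigroup 𝕜 X) (ι : V →L[𝕜] X) (C : ℝ) : Prop :=
  ∀ t : ℝ≥0, 0 < t → t ≤ 1 → NormIntoLE ι ((T.op t).comp ι) C

/-- The operator `B` on `X` leaves the subspace `V` invariant. -/
def LeavesInvariant (B : X →L[𝕜] X) (ι : V →L[𝕜] X) : Prop :=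
  ∀ v : V, B (ι v) ∈ Set.range ι

end Embedding

/-! Write `S(t) x` as the Dyson–Phillips series with terms `S₀(t) = T(t)` and `Sₙ₊₁(t) = ∫₀ᵗ T(t -
s) B Sₙ(s) ds`. Estimating the integrand by `‖T(t - s)‖_{X → V}` alone would require `r ^ (-α)` to
be integrable at `0`, which fails for `α ≥ 1`. Instead the integral is split at `t / 2`. For `s ≤ t
/ 2`, smoothing comes from `T(t - s)`, with `t - s ≥ t / 2`. For `s ≥ t / 2`, it comes from `Sₙ(s)`,
already bounded into `V` by a multiple of `s ^ (-α)`, after which `B` and `T(t - s)` act on `V`.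
Both halves are of order `t ^ (-α)`, and integration gains a factor `t`. On a short interval `(0,
δ]` each term is therefore at most half the previous bound (`exists_dysonTerm_lift`), and the series
converges in `V`.

For `t > δ`, use `S(t) = S(δ) S(t - δ)`. Since a semigroup is determined by its generator, the
estimate holds for every `S` generated by `A + B`. -/

namespace C0Semigroup

/-! ### Orbits: local boundedness and joint continuity. -/

variable {𝕜 X : Type*} [RCLike 𝕜] [NormedAddCommGroup X] [NormedSpace 𝕜 X]

/-- The operator `T(t)` for real `t`, extended by the identity to negative times. -/
noncomputable def flow (T : C0Semigroup 𝕜 X) (t : ℝ) : X →L[𝕜] X := T.op t.toNNReal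

theorem flow_coe (T : C0Semigroup 𝕜 X) (t : ℝ≥0) : T.flow t = T.op t := by
  simp [flow]

theorem flow_zero (T : C0Semigroup 𝕜 X) (x : X) : T.flow 0 x = x := by
  simp [flow, T.op_zero]

theorem flow_add (T : C0Semigroup 𝕜 X) {s t : ℝ} (hs : 0 ≤ s) (ht : 0 ≤ t) (x : X) :
    T.flow (s + t) x = T.flow s (T.flow t x) := by
  simp [flow, Real.toNNReal_add hs ht, T.op_add]

theorem continuous_flow (T : C0Semigroup 𝕜 X) (x : X) : Continuous fun t => T.flow t x :=
  (T.continuous_orbit x).comp continuous_real_toNNReal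

theorem exists_norm_flow_le [CompleteSpace X] (T : C0Semigroup 𝕜 X) (R : ℝ) :
    ∃ M : ℝ, 1 ≤ M ∧ ∀ t ≤ R, ‖T.flow t‖ ≤ M := by
  obtain ⟨M, hM⟩ := banach_steinhaus (g := fun t : Set.Icc 0 R.toNNReal => T.op t) fun x => by
    obtain ⟨K, hK⟩ := (isCompact_Icc (a := 0) (b := R.toNNReal)).exists_bound_of_continuousOn
      (T.continuous_orbit x).continuousOn
    exact ⟨K, fun t => hK t t.2⟩
  exact ⟨max M 1, le_max_right _ _, fun t ht =>
    (hM ⟨t.toNNReal, by simp, Real.toNNReal_le_toNNReal ht⟩).trans (le_max_left _ _)⟩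

theorem continuous_flow_uncurry [CompleteSpace X] (T : C0Semigroup 𝕜 X) :
    Continuous fun p : ℝ × X => T.flow p.1 p.2 := by
  rw [continuous_iff_continuousAt]
  rintro ⟨t₀, x₀⟩
  obtain ⟨M, -, hM⟩ := T.exists_norm_flow_le (t₀ + 1)
  have h₁ : Tendsto (fun p : ℝ × X => T.flow p.1 (p.2 - x₀)) (𝓝 (t₀, x₀)) (𝓝 0) := by
    refine squeeze_zero_norm' (a := fun p : ℝ × X => M * ‖p.2 - x₀‖) ?_ ?_
    · have : ∀ᶠ p : ℝ × X in 𝓝 (t₀, x₀), p.1 < t₀ + 1 :=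
        continuous_fst.continuousAt.eventually_lt_const (by simp)
      filter_upwards [this] with p hp
      exact (T.flow p.1).le_of_opNorm_le (hM _ hp.le) _
    · have : Continuous fun p : ℝ × X => M * ‖p.2 - x₀‖ := by fun_prop
      simpa using this.tendsto (t₀, x₀)
  have h₂ : Tendsto (fun p : ℝ × X => T.flow p.1 x₀) (𝓝 (t₀, x₀)) (𝓝 (T.flow t₀ x₀)) :=
    ((T.continuous_flow x₀).comp continuous_fst).tendsto (t₀, x₀)
  simpa [ContinuousAt] using h₁.add h₂

theorem continuous_flow_comp [CompleteSpace X] (T : C0Semigroup 𝕜 X) {Y : Type*}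
    [TopologicalSpace Y] {f : Y → ℝ} {g : Y → X} (hf : Continuous f) (hg : Continuous g) :
    Continuous fun y => T.flow (f y) (g y) :=
  T.continuous_flow_uncurry.comp (hf.prodMk hg)

theorem continuous_volterra_integrand [CompleteSpace X] {T : C0Semigroup 𝕜 X} {B : X →L[𝕜] X}
    {v : ℝ → X} (hv : Continuous v) (t : ℝ) :
    Continuous fun s => T.flow (t - s) (B (v s)) :=
  T.continuous_flow_comp (by fun_prop) (by fun_prop)

/-! ### The variation of constants equation and its Dyson–Phillips series. -/

section Volterra

variable [NormedSpace ℝ X]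

/-- The Volterra operator `v ↦ (t ↦ ∫₀ᵗ T(t - s) B v(s) ds)`. -/
noncomputable def volterra (T : C0Semigroup 𝕜 X) (B : X →L[𝕜] X) (v : ℝ → X) (t : ℝ) : X :=
  ∫ s in (0 : ℝ)..t, T.flow (t - s) (B (v s))

/-- The Dyson–Phillips terms: the iterates of the Volterra operator on the orbit of `x`. -/
noncomputable def dysonTerm (T : C0Semigroup 𝕜 X) (B : X →L[𝕜] X) (x : X) : ℕ → ℝ → X
  | 0 => fun t => T.flow t x
  | n + 1 => T.volterra B (dysonTerm T B x n)

/-- `u` is continuous and satisfies the variation of constants formula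
`u(t) = T(t) x + ∫₀ᵗ T(t - s) B u(s) ds` for `t ≥ 0`. -/
structure IsMild (T : C0Semigroup 𝕜 X) (B : X →L[𝕜] X) (x : X) (u : ℝ → X) : Prop where
  continuous : Continuous u
  eq : ∀ t, 0 ≤ t → u t = T.flow t x + T.volterra B u t

variable {T : C0Semigroup 𝕜 X} {B : X →L[𝕜] X}

/-- Integrating `s ^ n / n!` raises `n` by one. This factorial decay drives both convergence of the
series and uniqueness of mild solutions. -/
theorem norm_volterra_le {v : ℝ → X} {M F L R : ℝ} (n : ℕ) (hM : ∀ t ≤ R, ‖T.flow t‖ ≤ M)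
    (hL : M * ‖B‖ ≤ L)
    (hv : ∀ s, 0 ≤ s → s ≤ R → ‖v s‖ ≤ F * ((L * s) ^ n / n.factorial))
    {t : ℝ} (ht : 0 ≤ t) (htR : t ≤ R) :
    ‖T.volterra B v t‖ ≤ F * ((L * t) ^ (n + 1) / (n + 1).factorial) := by
  have hM0 : 0 ≤ M := (norm_nonneg _).trans (hM t htR)
  have hL0 : 0 ≤ L := (by positivity : 0 ≤ M * ‖B‖).trans hL
  have hb : ∀ s ∈ Set.Ioc 0 t, ‖T.flow (t - s) (B (v s))‖ ≤
      F * L ^ (n + 1) / n.factorial * s ^ n := by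
    intro s hs
    have h0 := hv s hs.1.le (hs.2.trans htR)
    calc ‖T.flow (t - s) (B (v s))‖ ≤ M * (‖B‖ * ‖v s‖) :=
          ((T.flow (t - s)).le_of_opNorm_le (hM _ (by linarith [hs.1])) _).trans
            (by gcongr; exact B.le_opNorm _)
      _ = M * ‖B‖ * ‖v s‖ := by ring
      _ ≤ L * (F * ((L * s) ^ n / n.factorial)) := by gcongr
      _ = _ := by ring
  calc ‖T.volterra B v t‖ ≤ ∫ s in (0 : ℝ)..t, F * L ^ (n + 1) / n.factorial * s ^ n :=
        intervalIntegral.norm_integral_le_of_norm_le ht (.of_forall hb)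
          ((by fun_prop : Continuous _).intervalIntegrable _ _)
    _ = _ := by
        rw [intervalIntegral.integral_const_mul, integral_pow, Nat.factorial_succ]
        push_cast
        field_simp
        simp [mul_pow, mul_assoc]

theorem norm_dysonTerm_le {M L R : ℝ} (hM : ∀ t ≤ R, ‖T.flow t‖ ≤ M) (hL : M * ‖B‖ ≤ L)
    (x : X) (n : ℕ) {t : ℝ} (ht : 0 ≤ t) (htR : t ≤ R) :
    ‖T.dysonTerm B x n t‖ ≤ M * ‖x‖ * ((L * t) ^ n / n.factorial) := by
  induction n generalizing t with
  | zero => simpa [dysonTerm] using (T.flow t).le_of_opNorm_le (hM t htR) x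
  | succ n ih =>
    exact norm_volterra_le n hM hL (fun s hs hsR => ih hs hsR) ht htR

theorem volterra_smul [SMulCommClass ℝ 𝕜 X] (c : 𝕜) (v : ℝ → X) (t : ℝ) :
    T.volterra B (fun s => c • v s) t = c • T.volterra B v t := by
  simp only [volterra, map_smul]
  exact intervalIntegral.integral_smul _ _

theorem IsMild.apply_zero {x : X} {u : ℝ → X} (hu : T.IsMild B x u) : u 0 = x := by
  simp [hu.eq 0 le_rfl, volterra, flow_zero]

theorem IsMild.smul [SMulCommClass ℝ 𝕜 X] (c : 𝕜) {x : X} {u : ℝ → X} (hu : T.IsMild B x u) :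
    T.IsMild B (c • x) fun t => c • u t where
  continuous := hu.continuous.const_smul c
  eq t ht := by rw [volterra_smul, hu.eq t ht, map_smul, smul_add]

variable [CompleteSpace X]

theorem continuous_volterra {v : ℝ → X} (hv : Continuous v) : Continuous (T.volterra B v) :=
  intervalIntegral.continuous_parametric_intervalIntegral_of_continuous
    (f := fun t s => T.flow (t - s) (B (v s)))
    (T.continuous_flow_comp (by fun_prop) (by fun_prop)) continuous_id

theorem volterra_add {v w : ℝ → X} (hv : Continuous v) (hw : Continuous w) (t : ℝ) :
    T.volterra B (fun s => v s + w s) t = T.volterra B v t + T.volterra B w t := by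
  simp only [volterra, map_add]
  exact intervalIntegral.integral_add ((continuous_volterra_integrand hv t).intervalIntegrable _ _)
    ((continuous_volterra_integrand hw t).intervalIntegrable _ _)

theorem continuous_dysonTerm (x : X) (n : ℕ) : Continuous (T.dysonTerm B x n) := by
  induction n with
  | zero => exact T.continuous_flow x
  | succ n ih => exact continuous_volterra ih

theorem IsMild.add {x y : X} {u v : ℝ → X} (hu : T.IsMild B x u) (hv : T.IsMild B y v) :
    T.IsMild B (x + y) fun t => u t + v t where
  continuous := hu.continuous.add hv.continuous
  eq t ht := by
    rw [volterra_add hu.continuous hv.continuous, hu.eq t ht, hv.eq t ht, map_add]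
    abel

/-- Here `u` is a fixed point of the Volterra operator, so its bound can be improved indefinitely by
iteration. -/
theorem IsMild.eq_zero {u : ℝ → X} (hu : T.IsMild B 0 u) {t : ℝ} (ht : 0 ≤ t) : u t = 0 := by
  obtain ⟨M, hM1, hM⟩ := T.exists_norm_flow_le t
  obtain ⟨F, hF⟩ := (isCompact_Icc (a := 0) (b := t)).exists_bound_of_continuousOn
    hu.continuous.continuousOn
  have key : ∀ n : ℕ, ∀ s, 0 ≤ s → s ≤ t →
      ‖u s‖ ≤ F * ((M * ‖B‖ * s) ^ n / n.factorial) := by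
    intro n
    induction n with
    | zero => intro s hs hst; simpa using hF s ⟨hs, hst⟩
    | succ n ih =>
      intro s hs hst
      rw [hu.eq s hs, map_zero, zero_add]
      exact norm_volterra_le n hM le_rfl ih hs hst
  have hlim := (FloorSemiring.tendsto_pow_div_factorial_atTop (M * ‖B‖ * t)).const_mul F
  rw [mul_zero] at hlim
  exact norm_le_zero_iff.1 (ge_of_tendsto' hlim fun n => key n t ht le_rfl)

theorem IsMild.unique [SMulCommClass ℝ 𝕜 X] {x : X} {u v : ℝ → X} (hu : T.IsMild B x u)
    (hv : T.IsMild B x v) {t : ℝ} (ht : 0 ≤ t) : u t = v t := by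
  have h := hu.add (hv.smul (-1))
  rw [neg_one_smul, add_neg_cancel] at h
  simpa [← sub_eq_add_neg, sub_eq_zero] using h.eq_zero ht

/-- Combined with uniqueness, this yields the semigroup law for the solution operators. -/
theorem IsMild.shift {x : X} {u : ℝ → X} (hu : T.IsMild B x u) {s : ℝ}
    (hs : 0 ≤ s) : T.IsMild B (u s) fun t => u (t + s) where
  continuous := hu.continuous.comp (by fun_prop)
  eq t ht := by
    have hint : ∀ a b : ℝ, IntervalIntegrable (fun r => T.flow (t + s - r) (B (u r)))
        MeasureTheory.volume a b := fun a b =>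
      (continuous_volterra_integrand hu.continuous (t + s)).intervalIntegrable _ _
    have h₁ : T.volterra B u (t + s) = T.flow t (T.volterra B u s) +
        T.volterra B (fun r => u (r + s)) t := by
      rw [volterra, ← intervalIntegral.integral_add_adjacent_intervals (hint 0 s) (hint s (t + s))]
      congr 1
      · rw [volterra, ← ContinuousLinearMap.intervalIntegral_comp_comm _
          ((continuous_volterra_integrand hu.continuous s).intervalIntegrable _ _)]
        refine intervalIntegral.integral_congr fun r hr => ?_
        rw [Set.uIcc_of_le hs] at hr
        rw [add_sub_assoc, flow_add _ ht (by linarith [hr.2])]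
      · have := intervalIntegral.integral_comp_add_right (a := 0) (b := t)
          (fun r => T.flow (t + s - r) (B (u r))) s
        rw [zero_add] at this
        rw [← this, volterra]
        simp only [add_sub_add_right_eq_sub]
    rw [hu.eq _ (add_nonneg ht hs), h₁, hu.eq s hs, map_add, flow_add _ ht hs]
    abel

theorem exists_isMild (T : C0Semigroup 𝕜 X) (B : X →L[𝕜] X) (x : X) :
    ∃ u : ℝ → X, T.IsMild B x u ∧ ∀ t, 0 ≤ t → HasSum (fun n => T.dysonTerm B x n t) (u t) := by
  -- The terms are controlled only for `t ≥ 0`; clamping the time makes `u` continuous on all of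
  -- `ℝ`.
  set u : ℝ → X := fun t => ∑' n, T.dysonTerm B x n (max t 0) with hu
  have hbound : ∀ R : ℝ, ∃ b : ℕ → ℝ, Summable b ∧
      ∀ n t, 0 ≤ t → t ≤ R → ‖T.dysonTerm B x n t‖ ≤ b n := by
    intro R
    obtain ⟨M, hM1, hM⟩ := T.exists_norm_flow_le R
    refine ⟨fun n => M * ‖x‖ * ((M * ‖B‖ * R) ^ n / n.factorial),
      (Real.summable_pow_div_factorial _).mul_left _, fun n t ht htR => ?_⟩
    refine (norm_dysonTerm_le hM le_rfl x n ht htR).trans ?_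
    have : 0 ≤ M := by linarith
    dsimp only
    gcongr
  have hsum : ∀ t, 0 ≤ t → HasSum (fun n => T.dysonTerm B x n t) (u t) := by
    intro t ht
    obtain ⟨b, hb, hbt⟩ := hbound t
    simpa [hu, ht] using (Summable.of_norm_bounded hb fun n => hbt n t ht le_rfl).hasSum
  have hcont : Continuous u := by
    rw [continuous_iff_continuousAt]
    intro t
    obtain ⟨b, hb, hbt⟩ := hbound (max (t + 1) 0)
    have : ContinuousOn u (Set.Iio (t + 1)) := by
      refine continuousOn_tsum (u := b) (fun n => Continuous.continuousOn ?_) hb fun n s hs => ?_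
      · exact (continuous_dysonTerm x n).comp (by fun_prop)
      · exact hbt n _ (le_max_right _ _) (max_le_max_right _ (le_of_lt hs))
    exact this.continuousAt (Iio_mem_nhds (by linarith))
  refine ⟨u, ⟨hcont, fun t ht => ?_⟩, hsum⟩
  obtain ⟨b, hb, hbt⟩ := hbound t
  obtain ⟨M, hM1, hM⟩ := T.exists_norm_flow_le t
  have h₁ : HasSum (fun n => T.dysonTerm B x (n + 1) t) (T.volterra B u t) := by
    refine intervalIntegral.hasSum_integral_of_dominated_convergence
      (fun n _ => M * (‖B‖ * b n)) (fun n =>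
        (continuous_volterra_integrand (continuous_dysonTerm x n) t).aestronglyMeasurable)
      (fun n => .of_forall fun s hs => ?_)
      (.of_forall fun s hs => (hb.mul_left _).mul_left _) (by simp)
      (.of_forall fun s hs => ?_)
    · rw [Set.uIoc_of_le ht] at hs
      refine ((T.flow (t - s)).le_of_opNorm_le (hM _ (by linarith [hs.1])) _).trans ?_
      gcongr
      exact B.le_of_opNorm_le_of_le le_rfl (hbt n s hs.1.le hs.2)
    · rw [Set.uIoc_of_le ht] at hs
      exact ((T.flow (t - s)).comp B).hasSum (hsum s hs.1.le)
  exact (hsum t ht).unique (HasSum.zero_add (f := fun n => T.dysonTerm B x n t) h₁)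

theorem IsMild.hasSum [SMulCommClass ℝ 𝕜 X] {x : X} {u : ℝ → X} (hu : T.IsMild B x u) {t : ℝ}
    (ht : 0 ≤ t) : HasSum (fun n => T.dysonTerm B x n t) (u t) := by
  obtain ⟨v, hv, hsum⟩ := T.exists_isMild B x
  exact hu.unique hv ht ▸ hsum t ht

end Volterra

end C0Semigroup

/-! ### Generators: the perturbed semigroup and uniqueness. -/

namespace C0Semigroup

variable {𝕜 X : Type*} [RCLike 𝕜] [NormedAddCommGroup X] [NormedSpace 𝕜 X]

theorem hasGeneratorAt_iff_mem_domain {T : C0Semigroup 𝕜 X} {x y : X} :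
    T.HasGeneratorAt x y ↔ ∃ h : x ∈ T.generator.domain, T.generator ⟨x, h⟩ = y :=
  ⟨fun h => ⟨⟨y, h⟩, (T.hasGeneratorAt_generator ⟨x, y, h⟩).unique h⟩,
    fun ⟨h, hy⟩ => hy ▸ T.hasGeneratorAt_generator ⟨x, h⟩⟩

theorem generator_eq_vadd {S T : C0Semigroup 𝕜 X} {B : X →L[𝕜] X}
    (h : ∀ x y, S.HasGeneratorAt x (B x + y) ↔ T.HasGeneratorAt x y) :
    S.generator = (B : X →ₗ[𝕜] X) +ᵥ T.generator := by
  refine LinearPMap.ext ?_ fun x hS hT => ?_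
  · ext x
    refine ⟨fun ⟨y, hy⟩ => ⟨y - B x, (h _ _).1 ?_⟩, fun ⟨y, hy⟩ => ⟨_, (h _ _).2 hy⟩⟩
    rwa [add_sub_cancel]
  · exact (S.hasGeneratorAt_generator ⟨x, hS⟩).unique
      ((h _ _).2 (T.hasGeneratorAt_generator ⟨x, hT⟩))

theorem flow_comm (T : C0Semigroup 𝕜 X) {s t : ℝ} (hs : 0 ≤ s) (ht : 0 ≤ t) (x : X) :
    T.flow s (T.flow t x) = T.flow t (T.flow s x) := by
  rw [← flow_add _ hs ht, ← flow_add _ ht hs, add_comm]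

variable [NormedSpace ℝ X]

/-- The substitution `s = h r` turns the mean into an integral over `[0, 1]` that is continuous in
`h` up to `h = 0`. -/
theorem tendsto_inv_smul_volterra [CompleteSpace X] {T : C0Semigroup 𝕜 X} {B : X →L[𝕜] X}
    {u : ℝ → X} (hu : Continuous u) :
    Tendsto (fun h : ℝ => h⁻¹ • T.volterra B u h) (𝓝[>] 0) (𝓝 (B (u 0))) := by
  have hc : Continuous fun h : ℝ => ∫ r in (0 : ℝ)..1, T.flow (h - h * r) (B (u (h * r))) :=
    intervalIntegral.continuous_parametric_intervalIntegral_of_continuous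
      (f := fun h r => T.flow (h - h * r) (B (u (h * r))))
      (T.continuous_flow_comp (by fun_prop) (by fun_prop)) continuous_const
  have h₀ := (hc.tendsto 0).mono_left (nhdsWithin_le_nhds (s := Set.Ioi 0))
  simp only [zero_mul, sub_zero, flow_zero, intervalIntegral.integral_const, one_smul] at h₀
  refine h₀.congr' (eventually_mem_nhdsWithin.mono fun h hh => ?_)
  have := intervalIntegral.integral_comp_mul_left (a := 0) (b := 1)
    (fun s => T.flow (h - s) (B (u s))) (ne_of_gt hh)
  simpa [volterra] using this

variable [IsScalarTower ℝ 𝕜 X]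

theorem hasGeneratorAt_iff_flow {T : C0Semigroup 𝕜 X} {x y : X} :
    T.HasGeneratorAt x y ↔
      Tendsto (fun h : ℝ => h⁻¹ • (T.flow h x - x)) (𝓝[>] 0) (𝓝 y) := by
  have h₁ : Tendsto ((↑) : ℝ≥0 → ℝ) (𝓝[>] 0) (𝓝[>] 0) :=
    tendsto_nhdsWithin_iff.2 ⟨(NNReal.continuous_coe.tendsto 0).mono_left nhdsWithin_le_nhds,
      eventually_mem_nhdsWithin.mono fun t ht => NNReal.coe_pos.2 ht⟩
  have h₂ : Tendsto Real.toNNReal (𝓝[>] 0) (𝓝[>] 0) :=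
    tendsto_nhdsWithin_iff.2 ⟨by simpa using
      (continuous_real_toNNReal.tendsto 0).mono_left nhdsWithin_le_nhds,
      eventually_mem_nhdsWithin.mono fun t ht => Real.toNNReal_pos.2 ht⟩
  constructor
  · intro h
    refine (h.comp h₂).congr' (eventually_mem_nhdsWithin.mono fun t ht => ?_)
    simp only [Function.comp_apply]
    rw [Real.coe_toNNReal t (le_of_lt ht),
      RCLike.real_smul_eq_coe_smul (K := 𝕜), RCLike.ofReal_inv, flow]
  · intro h
    refine (h.comp h₁).congr fun t => ?_
    rw [Function.comp_apply, flow_coe, RCLike.real_smul_eq_coe_smul (K := 𝕜), RCLike.ofReal_inv]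

theorem HasGeneratorAt.flow {T : C0Semigroup 𝕜 X} {x y : X} (h : T.HasGeneratorAt x y) {s : ℝ}
    (hs : 0 ≤ s) : T.HasGeneratorAt (T.flow s x) (T.flow s y) := by
  rw [hasGeneratorAt_iff_flow] at h ⊢
  refine (((T.flow s).continuous.tendsto y).comp h).congr'
    (eventually_mem_nhdsWithin.mono fun r hr => ?_)
  rw [Function.comp_apply, ContinuousLinearMap.map_smul_of_tower, map_sub,
    T.flow_comm hs (le_of_lt hr)]

variable [CompleteSpace X]

/-- The difference quotients of `S` and `T` differ by the Volterra mean, which tends to `B x`; so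
one converges exactly when the other does. -/
theorem hasGeneratorAt_add_iff {S T : C0Semigroup 𝕜 X} {B : X →L[𝕜] X}
    (hS : ∀ x, T.IsMild B x fun t => S.flow t x) (x y : X) :
    S.HasGeneratorAt x (B x + y) ↔ T.HasGeneratorAt x y := by
  have hlim := tendsto_inv_smul_volterra (T := T) (B := B) (hS x).continuous
  simp only [flow_zero] at hlim
  have heq : ∀ h ∈ Set.Ioi (0 : ℝ), h⁻¹ • (S.flow h x - x) =
      h⁻¹ • T.volterra B (fun t => S.flow t x) h + h⁻¹ • (T.flow h x - x) := by
    intro h hh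
    rw [(hS x).eq h (le_of_lt hh), ← smul_add]
    congr 1
    abel
  rw [hasGeneratorAt_iff_flow, hasGeneratorAt_iff_flow]
  constructor
  · intro h
    have := h.sub hlim
    rw [add_sub_cancel_left] at this
    refine this.congr' (eventually_mem_nhdsWithin.mono fun t ht => ?_)
    rw [heq t ht, add_sub_cancel_left]
  · intro h
    exact (hlim.add h).congr' (eventually_mem_nhdsWithin.mono fun t ht => (heq t ht).symm)

theorem IsMild.norm_le {T : C0Semigroup 𝕜 X} {B : X →L[𝕜] X} {x : X} {u : ℝ → X}
    (hu : T.IsMild B x u) {M t : ℝ} (hM : ∀ s ≤ t, ‖T.flow s‖ ≤ M) (ht : 0 ≤ t) :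
    ‖u t‖ ≤ M * Real.exp (M * ‖B‖ * t) * ‖x‖ := by
  have h₁ : HasSum (fun n : ℕ => M * ‖x‖ * ((M * ‖B‖ * t) ^ n / n.factorial))
      (M * ‖x‖ * Real.exp (M * ‖B‖ * t)) := by
    rw [Real.exp_eq_exp_ℝ]
    exact (NormedSpace.expSeries_div_hasSum_exp (𝔸 := ℝ) (M * ‖B‖ * t)).mul_left _
  rw [mul_right_comm, ← (hu.hasSum ht).tsum_eq]
  exact tsum_of_norm_bounded h₁ fun n => norm_dysonTerm_le hM le_rfl x n ht le_rfl

/-- Bounded perturbations of `C₀`-semigroups: the variation of constants formula is solved by a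
`C₀`-semigroup. -/
theorem exists_perturbation (T : C0Semigroup 𝕜 X) (B : X →L[𝕜] X) :
    ∃ S : C0Semigroup 𝕜 X, ∀ x, T.IsMild B x fun t => S.flow t x := by
  choose u hu _ using T.exists_isMild B
  choose M _ hM using T.exists_norm_flow_le
  let S : C0Semigroup 𝕜 X :=
    { op := fun t => LinearMap.mkContinuous
        { toFun := fun x => u x t
          map_add' := fun x y => (hu (x + y)).unique ((hu x).add (hu y)) t.2
          map_smul' := fun c x => (hu (c • x)).unique ((hu x).smul c) t.2 }
        _ fun x => (hu x).norm_le (hM t) t.2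
      op_zero := by
        ext x
        simpa using (hu x).apply_zero
      op_add := fun s t => by
        ext x
        simpa using ((hu x).shift t.2).unique (hu (u x t)) s.2
      continuous_orbit := fun x => (hu x).continuous.comp NNReal.continuous_coe }
  have hS : ∀ x t, 0 ≤ t → S.flow t x = u x t := fun x t ht => by
    simp [S, flow, ht]
  refine ⟨S, fun x => ⟨S.continuous_flow x, fun t ht => ?_⟩⟩
  rw [hS x t ht, (hu x).eq t ht]
  congr 1
  refine intervalIntegral.integral_congr fun s hs => ?_
  rw [Set.uIcc_of_le ht] at hs
  simp only [hS x s hs.1]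

theorem hasGeneratorAt_integral (T : C0Semigroup 𝕜 X) (x : X) {r : ℝ} (hr : 0 ≤ r) :
    T.HasGeneratorAt (∫ s in (0 : ℝ)..r, T.flow s x) (T.flow r x - x) := by
  have hint : ∀ a b, IntervalIntegrable (fun s => T.flow s x) MeasureTheory.volume a b :=
    fun a b => (T.continuous_flow x).intervalIntegrable a b
  have hd : ∀ a : ℝ, Tendsto (fun h : ℝ => h⁻¹ • ∫ s in a..a + h, T.flow s x) (𝓝[>] 0)
      (𝓝 (T.flow a x)) := by
    intro a
    have hs := ((T.continuous_flow x).integral_hasStrictDerivAt 0 a).hasDerivAt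
    refine hs.tendsto_slope_zero_right.congr fun h => ?_
    rw [intervalIntegral.integral_interval_sub_left (hint _ _) (hint _ _)]
  rw [hasGeneratorAt_iff_flow]
  have h0 := hd 0
  rw [flow_zero] at h0
  refine ((hd r).sub h0).congr' (eventually_mem_nhdsWithin.mono fun h hh => ?_)
  have hh : 0 ≤ h := le_of_lt hh
  have h₁ : T.flow h (∫ s in (0 : ℝ)..r, T.flow s x) = ∫ s in h..r + h, T.flow s x := by
    rw [← ContinuousLinearMap.intervalIntegral_comp_comm _ (hint _ _)]
    have := intervalIntegral.integral_comp_add_right (a := 0) (b := r) (fun s => T.flow s x) h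
    rw [zero_add] at this
    rw [← this]
    refine intervalIntegral.integral_congr fun s hs => ?_
    rw [Set.uIcc_of_le hr] at hs
    rw [add_comm, flow_add _ hh hs.1]
  simp only [h₁, ← smul_sub, zero_add]
  congr 1
  have e₁ := intervalIntegral.integral_add_adjacent_intervals (hint 0 r) (hint r (r + h))
  have e₂ := intervalIntegral.integral_add_adjacent_intervals (hint 0 h) (hint h (r + h))
  rw [sub_eq_sub_iff_add_eq_add, add_comm, e₁, ← e₂]
  exact add_comm _ _

theorem dense_hasGeneratorAt (T : C0Semigroup 𝕜 X) : Dense {x | ∃ y, T.HasGeneratorAt x y} := by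
  intro x
  have hc : Continuous fun h : ℝ => ∫ r in (0 : ℝ)..1, T.flow (h * r) x :=
    intervalIntegral.continuous_parametric_intervalIntegral_of_continuous
      (f := fun h r => T.flow (h * r) x)
      (T.continuous_flow_comp (by fun_prop) (by fun_prop)) continuous_const
  have h₀ := (hc.tendsto 0).mono_left (nhdsWithin_le_nhds (s := Set.Ioi 0))
  simp only [zero_mul, flow_zero, intervalIntegral.integral_const, sub_zero, one_smul] at h₀
  refine mem_closure_of_tendsto h₀ (eventually_mem_nhdsWithin.mono fun h hh => ?_)
  have := intervalIntegral.integral_comp_mul_left (a := 0) (b := 1)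
    (fun s => T.flow s x) (ne_of_gt hh)
  rw [this, mul_zero, mul_one, RCLike.real_smul_eq_coe_smul (K := 𝕜)]
  exact ⟨_, (T.hasGeneratorAt_integral x (le_of_lt hh)).smul _⟩

/-- The function `s ↦ S(t - s) S'(s) x` has zero right derivative on `[0, t)`, hence equal values at
`0` and `t`. -/
theorem flow_eq_of_hasGeneratorAt {S S' : C0Semigroup 𝕜 X}
    (h : ∀ x y, S'.HasGeneratorAt x y → S.HasGeneratorAt x y) {x y : X}
    (hx : S'.HasGeneratorAt x y) {t : ℝ} (ht : 0 ≤ t) : S.flow t x = S'.flow t x := by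
  have hc : Continuous fun s => S.flow (t - s) (S'.flow s x) :=
    S.continuous_flow_comp (by fun_prop) (S'.continuous_flow x)
  have hconst := constant_of_has_deriv_right_zero (a := 0) (b := t) hc.continuousOn
    fun s hs => by
      rw [← hasDerivWithinAt_Ioi_iff_Ici, hasDerivWithinAt_iff_tendsto_slope' (by simp)]
      have hz := hx.flow hs.1
      have hz' := h _ _ hz
      rw [hasGeneratorAt_iff_flow] at hz hz'
      have hsub : Tendsto (fun r : ℝ => r - s) (𝓝[>] s) (𝓝[>] 0) :=
        tendsto_nhdsWithin_iff.2 ⟨by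
          simpa using ((continuous_sub_right s).tendsto s).mono_left nhdsWithin_le_nhds,
          eventually_mem_nhdsWithin.mono fun r hr => Set.mem_Ioi.2 (sub_pos.2 hr)⟩
      have hlim := (hz.sub hz').comp hsub
      rw [sub_self] at hlim
      have hts : Tendsto (fun r : ℝ => t - r) (𝓝[>] s) (𝓝 (t - s)) :=
        ((continuous_sub_left t).tendsto s).mono_left nhdsWithin_le_nhds
      -- The slope at `s` is `S(t - r)` applied to the difference of the two quotients at `S'(s) x`,
      -- which tends to `0`; joint continuity finishes.
      have := (S.continuous_flow_uncurry.tendsto (t - s, 0)).comp (hts.prodMk_nhds hlim)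
      simp only [map_zero] at this
      refine this.congr' ?_
      filter_upwards [eventually_mem_nhdsWithin,
        (eventually_lt_nhds hs.2).filter_mono nhdsWithin_le_nhds] with r hr hrt
      have hr : s < r := hr
      have e₁ : S'.flow r x = S'.flow (r - s) (S'.flow s x) := by
        rw [← flow_add _ (by linarith) hs.1, sub_add_cancel]
      have e₂ : S.flow (t - s) (S'.flow s x) = S.flow (t - r) (S.flow (r - s) (S'.flow s x)) := by
        rw [← flow_add _ (by linarith) (by linarith), sub_add_sub_cancel]
      simp only [Function.comp_apply, slope_def_module]
      rw [e₁, e₂, ← smul_sub, sub_sub_sub_cancel_right, ContinuousLinearMap.map_smul_of_tower,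
        map_sub]
  have := hconst t ⟨ht, le_rfl⟩
  simpa [flow_zero] using this.symm

/-- A `C₀`-semigroup is determined by its generator. -/
theorem op_eq_of_generator_eq {S S' : C0Semigroup 𝕜 X} (h : S.generator = S'.generator) :
    S.op = S'.op := by
  funext t
  refine ContinuousLinearMap.coeFn_injective
    ((S.op t).continuous.ext_on S'.dense_hasGeneratorAt (S'.op t).continuous ?_)
  rintro x ⟨y, hy⟩
  have h' : ∀ x y, S'.HasGeneratorAt x y → S.HasGeneratorAt x y := fun x y hxy => by
    rw [hasGeneratorAt_iff_mem_domain] at hxy ⊢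
    rwa [h]
  have := flow_eq_of_hasGeneratorAt h' hy t.coe_nonneg
  rwa [flow_coe, flow_coe] at this

end C0Semigroup

/-! ### Factoring operators through the embedding. -/

section Lift

variable {𝕜 E V X : Type*} [RCLike 𝕜] [NormedAddCommGroup E] [NormedSpace 𝕜 E]
  [NormedAddCommGroup V] [NormedSpace 𝕜 V] [NormedAddCommGroup X] [NormedSpace 𝕜 X]
  {ι : V →L[𝕜] X}

theorem exists_linearMap_lift (hι : Function.Injective ι) {Q : E →L[𝕜] X}
    (hQ : ∀ e, Q e ∈ Set.range ι) : ∃ L : E →ₗ[𝕜] V, ∀ e, ι (L e) = Q e := by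
  choose f hf using hQ
  exact ⟨{ toFun := f
           map_add' := fun x y => hι (by simp [hf])
           map_smul' := fun c x => hι (by simp [hf]) }, hf⟩

theorem NormIntoLE.exists_lift (hι : Function.Injective ι) {Q : E →L[𝕜] X} {K : ℝ}
    (hQ : NormIntoLE ι Q K) (hK : 0 ≤ K) :
    ∃ L : E →L[𝕜] V, (∀ e, ι (L e) = Q e) ∧ ‖L‖ ≤ K := by
  obtain ⟨L, hL⟩ := exists_linearMap_lift hι fun e => hQ.1 ⟨e, rfl⟩
  exact ⟨L.mkContinuous K fun e => hQ.2 e _ (hL e), hL, L.mkContinuous_norm_le hK _⟩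

/-- Closed graph theorem: limits in `V` are also limits in `X`, where `B` is continuous. -/
theorem LeavesInvariant.exists_lift [CompleteSpace V] (hι : Function.Injective ι)
    {B : X →L[𝕜] X} (hB : LeavesInvariant B ι) :
    ∃ B' : V →L[𝕜] V, ∀ v, ι (B' v) = B (ι v) := by
  obtain ⟨L, hL⟩ := exists_linearMap_lift (Q := B.comp ι) hι hB
  refine ⟨⟨L, L.continuous_of_seq_closed_graph fun u x y hu hLu => hι ?_⟩, hL⟩
  refine tendsto_nhds_unique ((ι.continuous.tendsto y).comp hLu) ?_
  rw [hL]
  exact (((B.comp ι).continuous.tendsto x).comp hu).congr fun n => (hL (u n)).symm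

end Lift

/-! ### Estimates into `V`. -/

namespace C0Semigroup

variable {𝕜 V X : Type*} [RCLike 𝕜] [NormedAddCommGroup V] [NormedSpace 𝕜 V]
  [NormedAddCommGroup X] [NormedSpace 𝕜 X] [CompleteSpace X]
  {ι : V →L[𝕜] X} {T : C0Semigroup 𝕜 X} {B : X →L[𝕜] X}

/-- Since `T(r) = T(ε) T(r - ε)`, orbits are continuous into `V` at positive times. -/
theorem continuousOn_lift (hι : Function.Injective ι) {J : ℝ → X →L[𝕜] V} {t : ℝ}
    (hJ : ∀ r, 0 < r → r ≤ t → ∀ x, ι (J r x) = T.flow r x) {g : ℝ → X} (hg : Continuous g) :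
    ContinuousOn (fun s => J (t - s) (g s)) (Set.Ioo 0 t) := by
  intro s₀ hs₀
  set ε := (t - s₀) / 2 with hε
  have hε0 : 0 < ε := by have := hs₀.2; linarith
  have hc : Continuous fun s => J ε (T.flow (t - s - ε) (g s)) :=
    (J ε).continuous.comp (T.continuous_flow_comp (by fun_prop) hg)
  refine (hc.continuousAt.congr ?_).continuousWithinAt
  have hs₁ : s₀ < t - ε := by linarith
  filter_upwards [eventually_lt_nhds hs₁, eventually_gt_nhds hs₀.1] with s hs hs0
  refine hι ?_
  rw [hJ ε hε0 (by linarith [hs₀.1]), hJ (t - s) (by linarith) (by linarith),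
    ← flow_add _ hε0.le (by linarith)]
  congr 2
  ring

variable [NormedSpace ℝ X] [NormedSpace ℝ V] [CompleteSpace V]

/-- The integral is formed in `V` over the open interval, since `J` is a lift only at positive
times; continuity there and the bound `D` give integrability. -/
theorem exists_volterra_lift (hι : Function.Injective ι) {J : ℝ → X →L[𝕜] V} {t : ℝ}
    (hJ : ∀ r, 0 < r → r ≤ t → ∀ x, ι (J r x) = T.flow r x) {v : ℝ → X} (hv : Continuous v)
    (ht : 0 ≤ t) {D : ℝ} (hD : ∀ s ∈ Set.Ioo 0 t, ‖J (t - s) (B (v s))‖ ≤ D) :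
    ∃ w, ι w = T.volterra B v t ∧ ‖w‖ ≤ D * t := by
  have hint : MeasureTheory.IntegrableOn (fun s => J (t - s) (B (v s))) (Set.Ioo 0 t) :=
    MeasureTheory.IntegrableOn.of_bound (by simp)
      ((continuousOn_lift hι hJ (B.continuous.comp hv)).aestronglyMeasurable measurableSet_Ioo)
      D ((MeasureTheory.ae_restrict_iff' measurableSet_Ioo).2 (.of_forall hD))
  refine ⟨∫ s in Set.Ioo 0 t, J (t - s) (B (v s)), ?_, ?_⟩
  · rw [← ContinuousLinearMap.integral_comp_comm _ hint, volterra,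
      intervalIntegral.integral_of_le ht, MeasureTheory.integral_Ioc_eq_integral_Ioo]
    exact MeasureTheory.setIntegral_congr_fun measurableSet_Ioo fun s hs =>
      hJ _ (sub_pos.2 hs.2) (by linarith [hs.1]) _
  · simpa [ht] using MeasureTheory.norm_setIntegral_le_of_norm_le_const
      (μ := MeasureTheory.volume) (by simp) hD

/-- The splitting at `t / 2`. The first part of `hδ` halves the `V`-bound at each step; the term `M
* ‖B‖` makes the `X`-norms decay at the same rate. -/
theorem exists_dysonTerm_lift (hι : Function.Injective ι) {C M α δ : ℝ} (hα : 0 ≤ α)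
    (hC : 0 ≤ C) (hM : ∀ t ≤ δ, ‖T.flow t‖ ≤ M)
    {J : ℝ → X →L[𝕜] V} (hJ : ∀ t, 0 < t → t ≤ δ → ∀ x, ι (J t x) = T.flow t x)
    (hJC : ∀ t, 0 < t → t ≤ δ → ‖J t‖ ≤ C * t ^ (-α))
    {J' : ℝ → V →L[𝕜] V} (hJ' : ∀ t, 0 < t → t ≤ δ → ∀ v, ι (J' t v) = T.flow t (ι v))
    (hJC' : ∀ t, 0 < t → t ≤ δ → ‖J' t‖ ≤ C)
    {B' : V →L[𝕜] V} (hB' : ∀ v, ι (B' v) = B (ι v))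
    (hδ : (C * 2 ^ α * (‖B‖ + ‖B'‖) + M * ‖B‖) * δ ≤ 1 / 2)
    (x : X) (n : ℕ) {t : ℝ} (ht : 0 < t) (htδ : t ≤ δ) :
    ∃ w, ι w = T.dysonTerm B x n t ∧ ‖w‖ ≤ (C + M) * (1 / 2) ^ n * ‖x‖ * t ^ (-α) := by
  have hM0 : 0 ≤ M := (norm_nonneg _).trans (hM t htδ)
  have hδ0 : 0 < δ := ht.trans_le htδ
  induction n generalizing t with
  | zero =>
    refine ⟨J t x, hJ t ht htδ x, ((J t).le_of_opNorm_le (hJC t ht htδ) x).trans ?_⟩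
    rw [pow_zero, mul_one, mul_right_comm]
    gcongr
    linarith
  | succ n ih =>
    have hhalf : (t / 2) ^ (-α) = 2 ^ α * t ^ (-α) := by
      rw [Real.div_rpow ht.le zero_le_two, Real.rpow_neg zero_le_two, div_inv_eq_mul, mul_comm]
    have hv : ∀ s, 0 < s → s ≤ t → ‖T.dysonTerm B x n s‖ ≤ (C + M) * (1 / 2) ^ n * ‖x‖ := by
      intro s hs hst
      have hsδ := hst.trans htδ
      have hMB : M * ‖B‖ * s ≤ 1 / 2 := by
        refine le_trans ?_ hδ
        gcongr
        exact le_add_of_nonneg_left (by positivity)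
      calc _ ≤ M * ‖x‖ * ((M * ‖B‖ * s) ^ n / n.factorial) :=
            norm_dysonTerm_le hM le_rfl x n hs.le hsδ
        _ ≤ M * ‖x‖ * (M * ‖B‖ * s) ^ n := by
            gcongr
            exact div_le_self (by positivity) (by exact_mod_cast n.factorial_pos)
        _ ≤ (C + M) * ‖x‖ * (1 / 2) ^ n := by
            gcongr
            linarith
        _ = _ := by ring
    have hD : ∀ s ∈ Set.Ioo 0 t, ‖J (t - s) (B (T.dysonTerm B x n s))‖ ≤
        C * (2 ^ α * t ^ (-α)) * ((‖B‖ + ‖B'‖) * ((C + M) * (1 / 2) ^ n * ‖x‖)) := by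
      intro s hs
      have hts : 0 < t - s := sub_pos.2 hs.2
      have htsδ : t - s ≤ δ := by linarith [hs.1]
      rw [← hhalf]
      -- Early times use the `X`-bound `hv` and smoothing by `T(t - s)`; late times use the
      -- induction hypothesis in `V`.
      rcases le_total s (t / 2) with h | h
      · calc _ ≤ C * (t - s) ^ (-α) * (‖B‖ * ((C + M) * (1 / 2) ^ n * ‖x‖)) :=
              (J (t - s)).le_of_opNorm_le_of_le (hJC _ hts htsδ)
                (B.le_of_opNorm_le_of_le le_rfl (hv s hs.1 hs.2.le))
          _ ≤ _ := by
              gcongr C * ?_ * (?_ * _)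
              · exact Real.rpow_le_rpow_of_nonpos (by linarith) (by linarith) (by linarith)
              · exact le_add_of_nonneg_right (norm_nonneg _)
      · obtain ⟨w, hw, hwn⟩ := ih hs.1 (hs.2.le.trans htδ)
        have e : J (t - s) (B (T.dysonTerm B x n s)) = J' (t - s) (B' w) := by
          refine hι ?_
          rw [hJ _ hts htsδ, hJ' _ hts htsδ, hB', hw]
        rw [e]
        calc _ ≤ C * (‖B'‖ * ((C + M) * (1 / 2) ^ n * ‖x‖ * s ^ (-α))) :=
              (J' (t - s)).le_of_opNorm_le_of_le (hJC' _ hts htsδ)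
                (B'.le_of_opNorm_le_of_le le_rfl hwn)
          _ = C * s ^ (-α) * (‖B'‖ * ((C + M) * (1 / 2) ^ n * ‖x‖)) := by ring
          _ ≤ _ := by
              gcongr C * ?_ * (?_ * _)
              · exact Real.rpow_le_rpow_of_nonpos (by linarith) h (by linarith)
              · exact le_add_of_nonneg_left (norm_nonneg _)
    obtain ⟨w, hw, hwn⟩ := exists_volterra_lift hι
      (fun r hr hrt => hJ r hr (hrt.trans htδ)) (continuous_dysonTerm x n) ht.le hD
    refine ⟨w, hw, hwn.trans ?_⟩
    have hq : C * 2 ^ α * (‖B‖ + ‖B'‖) * t ≤ 1 / 2 := by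
      refine le_trans ?_ hδ
      gcongr
      exact le_add_of_nonneg_right (by positivity)
    calc _ = C * 2 ^ α * (‖B‖ + ‖B'‖) * t * ((C + M) * (1 / 2) ^ n * ‖x‖ * t ^ (-α)) := by ring
      _ ≤ 1 / 2 * ((C + M) * (1 / 2) ^ n * ‖x‖ * t ^ (-α)) := by gcongr
      _ = _ := by ring

/-- Small-time ultracontractivity of the perturbed orbits. -/
theorem exists_mild_lift [IsScalarTower ℝ 𝕜 X] (hι : Function.Injective ι)
    {C α : ℝ} (hα : 0 ≤ α) (hC : 0 ≤ C)
    (hT : T.UltracontractiveWith ι C α) (hTV : T.BoundedOnWith ι C) (hB : LeavesInvariant B ι) :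
    ∃ δ K : ℝ, 0 < δ ∧ δ ≤ 1 ∧ 0 ≤ K ∧ ∀ x u, T.IsMild B x u → ∀ t, 0 < t → t ≤ δ →
      ∃ w, ι w = u t ∧ ‖w‖ ≤ K * t ^ (-α) * ‖x‖ := by
  obtain ⟨B', hB'⟩ := hB.exists_lift hι
  obtain ⟨M, hM1, hM⟩ := T.exists_norm_flow_le 1
  have hJ : ∀ t : ℝ, ∃ J : X →L[𝕜] V, 0 < t → t ≤ 1 →
      (∀ x, ι (J x) = T.flow t x) ∧ ‖J‖ ≤ C * t ^ (-α) := by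
    intro t
    by_cases h : 0 < t ∧ t ≤ 1
    · have h1 := hT t.toNNReal (Real.toNNReal_pos.2 h.1) (Real.toNNReal_le_one.2 h.2)
      rw [Real.coe_toNNReal t h.1.le] at h1
      obtain ⟨J, hJ⟩ := h1.exists_lift hι (mul_nonneg hC (Real.rpow_nonneg h.1.le _))
      exact ⟨J, fun _ _ => hJ⟩
    · exact ⟨0, fun h0 h1 => (h ⟨h0, h1⟩).elim⟩
  have hJ' : ∀ t : ℝ, ∃ J : V →L[𝕜] V, 0 < t → t ≤ 1 →
      (∀ v, ι (J v) = T.flow t (ι v)) ∧ ‖J‖ ≤ C := by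
    intro t
    by_cases h : 0 < t ∧ t ≤ 1
    · obtain ⟨J, hJ⟩ := (hTV t.toNNReal (Real.toNNReal_pos.2 h.1)
        (Real.toNNReal_le_one.2 h.2)).exists_lift hι hC
      exact ⟨J, fun _ _ => hJ⟩
    · exact ⟨0, fun h0 h1 => (h ⟨h0, h1⟩).elim⟩
  choose J hJ using hJ
  choose J' hJ' using hJ'
  set L := C * 2 ^ α * (‖B‖ + ‖B'‖) + M * ‖B‖ with hL
  have hL0 : 0 ≤ L := by positivity
  have hδ1 : 1 / (2 * (L + 1)) ≤ 1 := by
    rw [div_le_one (by positivity)]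
    linarith
  have hδL : L * (1 / (2 * (L + 1))) ≤ 1 / 2 := by
    rw [mul_one_div, div_le_div_iff₀ (by positivity) (by positivity)]
    linarith
  refine ⟨1 / (2 * (L + 1)), (C + M) * 2, by positivity, hδ1, by positivity,
    fun x u hu t ht htδ => ?_⟩
  choose w hw hwn using fun n => exists_dysonTerm_lift hι hα hC
    (fun t h => hM t (h.trans hδ1)) (fun t h0 h => (hJ t h0 (h.trans hδ1)).1)
    (fun t h0 h => (hJ t h0 (h.trans hδ1)).2) (fun t h0 h => (hJ' t h0 (h.trans hδ1)).1)
    (fun t h0 h => (hJ' t h0 (h.trans hδ1)).2) hB' hδL x n ht htδ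
  have hgeom : HasSum (fun n : ℕ => (C + M) * (1 / 2) ^ n * ‖x‖ * t ^ (-α))
      ((C + M) * 2 * ‖x‖ * t ^ (-α)) :=
    ((hasSum_geometric_two.mul_left _).mul_right _).mul_right _
  refine ⟨∑' n, w n, ?_, ?_⟩
  · have hs := ι.hasSum (Summable.of_norm_bounded hgeom.summable hwn).hasSum
    simp only [hw] at hs
    exact hs.unique (hu.hasSum ht.le)
  · rw [mul_right_comm]
    exact tsum_of_norm_bounded hgeom hwn

theorem exists_ultracontractiveWith_of_isMild [IsScalarTower ℝ 𝕜 X] (hι : Function.Injective ι)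
    {C α : ℝ} (hα : 0 ≤ α) (hC : 0 ≤ C) (hT : T.UltracontractiveWith ι C α)
    (hTV : T.BoundedOnWith ι C) (hB : LeavesInvariant B ι) {S : C0Semigroup 𝕜 X}
    (hS : ∀ x, T.IsMild B x fun t => S.flow t x) :
    ∃ C' : ℝ, 1 ≤ C' ∧ S.UltracontractiveWith ι C' α := by
  obtain ⟨δ, K, hδ, hδ1, hK, hlift⟩ := exists_mild_lift hι hα hC hT hTV hB
  obtain ⟨M, hM1, hM⟩ := S.exists_norm_flow_le 1
  set C' := 1 + K + K * δ ^ (-α) * M with hC'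
  have hp : 0 ≤ K * δ ^ (-α) * M := by positivity
  have key : ∀ t : ℝ, 0 < t → t ≤ 1 → ∀ x, ∃ w, ι w = S.flow t x ∧
      ‖w‖ ≤ C' * t ^ (-α) * ‖x‖ := by
    intro t ht ht1 x
    rcases le_total t δ with h | h
    · obtain ⟨w, hw, hwn⟩ := hlift x _ (hS x) t ht h
      refine ⟨w, hw, hwn.trans ?_⟩
      gcongr
      linarith
    · obtain ⟨w, hw, hwn⟩ := hlift _ _ (hS (S.flow (t - δ) x)) δ hδ le_rfl
      refine ⟨w, ?_, ?_⟩
      · rw [hw, ← flow_add _ hδ.le (sub_nonneg.2 h), add_sub_cancel]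
      -- Past `δ` the bound is a constant, absorbed because `t ^ (-α) ≥ 1` on `(0, 1]`.
      · have h1 : 1 ≤ t ^ (-α) := Real.one_le_rpow_of_pos_of_le_one_of_nonpos ht ht1 (by linarith)
        calc ‖w‖ ≤ K * δ ^ (-α) * (M * ‖x‖) := hwn.trans (by
              gcongr
              exact (S.flow (t - δ)).le_of_opNorm_le (hM _ (by linarith)) x)
          _ = K * δ ^ (-α) * M * 1 * ‖x‖ := by ring
          _ ≤ C' * t ^ (-α) * ‖x‖ := by
              gcongr
              linarith
  refine ⟨C', by linarith, fun t ht ht1 => ⟨?_, fun x v hv => ?_⟩⟩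
  · rintro _ ⟨x, rfl⟩
    obtain ⟨w, hw, -⟩ := key t ht ht1 x
    exact ⟨w, by rw [hw, flow_coe]⟩
  · obtain ⟨w, hw, hwn⟩ := key t ht ht1 x
    rw [flow_coe, ← hv] at hw
    rwa [← hι hw]

end C0Semigroup

theorem theorem1p1 {𝕜 X V : Type*} [RCLike 𝕜]
    [NormedAddCommGroup X] [NormedSpace 𝕜 X] [CompleteSpace X]
    [NormedAddCommGroup V] [NormedSpace 𝕜 V] [CompleteSpace V]
    (ι : V →L[𝕜] X) (hι : Function.Injective ι)
    (T : C0Semigroup 𝕜 X) (C α : ℝ) (hC : 1 ≤ C) (hα : 0 < α)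
    (hT : T.UltracontractiveWith ι C α) (hTV : T.BoundedOnWith ι C)
    (B : X →L[𝕜] X) (hB : LeavesInvariant B ι) :
    -- `B +ᵥ A` is the operator `A + B` with domain `dom(A)`
    (∃ S : C0Semigroup 𝕜 X, S.generator = (B : X →ₗ[𝕜] X) +ᵥ T.generator) ∧
    ∀ S : C0Semigroup 𝕜 X, S.generator = (B : X →ₗ[𝕜] X) +ᵥ T.generator →
      ∃ C' : ℝ, 1 ≤ C' ∧ S.UltracontractiveWith ι C' α := by
  let _ : NormedSpace ℝ X := NormedSpace.restrictScalars ℝ 𝕜 X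
  let _ : NormedSpace ℝ V := NormedSpace.restrictScalars ℝ 𝕜 V
  have : IsScalarTower ℝ 𝕜 X := IsScalarTower.of_algebraMap_smul fun _ _ => rfl
  obtain ⟨S₀, hS₀⟩ := T.exists_perturbation B
  have hgen := C0Semigroup.generator_eq_vadd (C0Semigroup.hasGeneratorAt_add_iff hS₀)
  refine ⟨⟨S₀, hgen⟩, fun S hS => ?_⟩
  obtain ⟨C', hC', hU⟩ := C0Semigroup.exists_ultracontractiveWith_of_isMild hι hα.le
    (zero_le_one.trans hC) hT hTV hB hS₀
  refine ⟨C', hC', fun t ht ht1 => ?_⟩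
  rw [C0Semigroup.op_eq_of_generator_eq (hS.trans hgen.symm)]
  exact hU t ht ht1
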